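/- For positive integers $k$ and $t$, let $D(k,t)$ be the (infinite, simple, undirected) distance graph whose vertex set is $\mathbb{Z}$ and in which two distinct integers $i,j$ are adjacent if and only if $|i-j|\in\{k,t\}$. For a graph $G$, the packing chromatic number $\chi_\rho(G)$ is the smallest integer $p$ for which the vertex set of $G$ can be partitioned into (possibly empty) classes $X_1,\dots,X_p$ such that, for every $i$, any two distinct vertices of $X_i$ are at distance greater than $i$ in $G$. Theorem. Let $k$ and $t$ be odd, coprime positive integers with $t\ge 825$. Then $\chi_\rho(D(k,t))\le 30$. -/

import Mathlib

namespace PackingColoring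

/-- The distance graph of a set `D` of positive integers: its vertices are the integers, and two
distinct integers `i`, `j` are adjacent if and only if `|i - j| ∈ D`. -/
def distanceGraph (D : Set ℕ) : SimpleGraph ℤ where
  Adj i j := i ≠ j ∧ (i - j).natAbs ∈ D
  symm := ⟨fun i j h => ⟨h.1.symm, by
    rw [← Int.natAbs_neg, neg_sub]
    exact h.2⟩⟩
  loopless := ⟨fun _ h => h.1 rfl⟩

/-- A set `X` of vertices is an `i`-packing of `G` if any two distinct vertices of `X` are at
distance greater than `i` (vertices in different components are at distance `⊤`). -/
def IsPacking {V : Type*} (G : SimpleGraph V) (i : ℕ) (X : Set V) : Prop :=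
  ∀ u ∈ X, ∀ v ∈ X, u ≠ v → (i : ℕ∞) < G.edist u v

/-- A packing `p`-coloring of `G`, given as a map `c` to the colors `1, ..., p`: for every color
`i`, the class of vertices of color `i` (possibly empty) is an `i`-packing. -/
def IsPackingColoring {V : Type*} (G : SimpleGraph V) (p : ℕ) (c : V → ℕ) : Prop :=
  (∀ v, c v ∈ Set.Icc 1 p) ∧ ∀ i ∈ Set.Icc 1 p, IsPacking G i {v | c v = i}

/-- The packing chromatic number of `G`: the smallest `p` for which `G` has a packing
`p`-coloring, and `⊤` if there is no such `p`. -/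
noncomputable def packingChromaticNumber {V : Type*} (G : SimpleGraph V) : ℕ∞ :=
  ⨅ p ∈ {p : ℕ | ∃ c : V → ℕ, IsPackingColoring G p c}, (p : ℕ∞)

end PackingColoring

namespace PackingColoring

/-! ### Two periodic patterns -/

/-! Since `k` and `t` are coprime, `D(k,t)` is the quotient of the square grid by the translation
`(t, -k)`. So it suffices to find a packing coloring of the grid, for the ℓ¹ distance, that is
invariant under this translation.

The table gives a packing coloring with 17 colors, but its periods are 24. To adapt it, `m ≡ t (mod
24)` extra columns are inserted per `t` columns, and the pattern is slid vertically by ±1 at each.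
The unit of horizontal distance gained at an insertion pays for the slide, so table colors stay
separated (`color_packing_grid`), and the slides can be made to add up to `k` mod 24. An inserted
column has color 1 on even points and the 13 unused colors on odd points. Columns are at least 25
apart, and their patterns are offset so that neighbors do not clash (`color_packing_line`).
`exists_cutting` fits all these congruences, which requires `t ≥ 25 * 33 = 825`. -/

/-- A `24 × 24` table whose periodic extension is a packing coloring of the square grid with the
colors `1, ..., 15, 22, 23`. -/
def gridRows : List (List ℕ) :=
  [
   [1, 5, 1, 9, 1, 3, 1, 2, 1, 3, 1, 7, 1, 5, 1, 6, 1, 3, 1, 2, 1, 3, 1, 4],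
   [3, 1, 2, 1, 12, 1, 4, 1, 11, 1, 2, 1, 3, 1, 2, 1, 14, 1, 4, 1, 5, 1, 2, 1],
   [1, 7, 1, 3, 1, 2, 1, 3, 1, 5, 1, 9, 1, 4, 1, 3, 1, 2, 1, 3, 1, 6, 1, 15],
   [2, 1, 4, 1, 5, 1, 8, 1, 2, 1, 3, 1, 2, 1, 10, 1, 5, 1, 8, 1, 2, 1, 3, 1],
   [1, 3, 1, 2, 1, 3, 1, 7, 1, 4, 1, 6, 1, 3, 1, 2, 1, 3, 1, 9, 1, 4, 1, 5],
   [11, 1, 6, 1, 10, 1, 2, 1, 3, 1, 2, 1, 5, 1, 7, 1, 4, 1, 2, 1, 3, 1, 2, 1],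
   [1, 2, 1, 3, 1, 4, 1, 5, 1, 13, 1, 3, 1, 2, 1, 3, 1, 6, 1, 5, 1, 7, 1, 3],
   [4, 1, 5, 1, 2, 1, 3, 1, 2, 1, 23, 1, 4, 1, 11, 1, 2, 1, 3, 1, 2, 1, 22, 1],
   [1, 3, 1, 7, 1, 9, 1, 6, 1, 3, 1, 2, 1, 3, 1, 5, 1, 12, 1, 4, 1, 3, 1, 2],
   [14, 1, 2, 1, 3, 1, 2, 1, 4, 1, 5, 1, 8, 1, 2, 1, 3, 1, 2, 1, 10, 1, 5, 1],
   [1, 8, 1, 4, 1, 5, 1, 3, 1, 2, 1, 3, 1, 6, 1, 4, 1, 7, 1, 3, 1, 2, 1, 3],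
   [2, 1, 3, 1, 2, 1, 11, 1, 7, 1, 10, 1, 2, 1, 3, 1, 2, 1, 5, 1, 6, 1, 4, 1],
   [1, 5, 1, 6, 1, 3, 1, 2, 1, 3, 1, 4, 1, 5, 1, 9, 1, 3, 1, 2, 1, 3, 1, 7],
   [3, 1, 2, 1, 15, 1, 4, 1, 5, 1, 2, 1, 3, 1, 2, 1, 13, 1, 4, 1, 11, 1, 2, 1],
   [1, 4, 1, 3, 1, 2, 1, 3, 1, 12, 1, 14, 1, 7, 1, 3, 1, 2, 1, 3, 1, 5, 1, 9],
   [2, 1, 10, 1, 5, 1, 8, 1, 2, 1, 3, 1, 2, 1, 4, 1, 5, 1, 8, 1, 2, 1, 3, 1],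
   [1, 3, 1, 2, 1, 3, 1, 9, 1, 4, 1, 5, 1, 3, 1, 2, 1, 3, 1, 7, 1, 4, 1, 6],
   [5, 1, 7, 1, 4, 1, 2, 1, 3, 1, 2, 1, 11, 1, 6, 1, 10, 1, 2, 1, 3, 1, 2, 1],
   [1, 2, 1, 3, 1, 6, 1, 5, 1, 7, 1, 3, 1, 2, 1, 3, 1, 4, 1, 5, 1, 12, 1, 3],
   [4, 1, 11, 1, 2, 1, 3, 1, 2, 1, 22, 1, 4, 1, 5, 1, 2, 1, 3, 1, 2, 1, 23, 1],
   [1, 3, 1, 5, 1, 13, 1, 4, 1, 3, 1, 2, 1, 3, 1, 7, 1, 9, 1, 6, 1, 3, 1, 2],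
   [8, 1, 2, 1, 3, 1, 2, 1, 10, 1, 5, 1, 15, 1, 2, 1, 3, 1, 2, 1, 4, 1, 5, 1],
   [1, 6, 1, 4, 1, 7, 1, 3, 1, 2, 1, 3, 1, 8, 1, 4, 1, 5, 1, 3, 1, 2, 1, 3],
   [2, 1, 3, 1, 2, 1, 5, 1, 6, 1, 4, 1, 2, 1, 3, 1, 2, 1, 11, 1, 7, 1, 10, 1]]

def gridEntry (x y : ℕ) : ℕ := (gridRows.getD x []).getD y 0

def gridCells (c : ℕ) : List (ℕ × ℕ) :=
  ((List.range 24).product (List.range 24)).filter fun p => gridEntry p.1 p.2 == c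

/-- Distance to `0` in `ℤ/24`. -/
def cyclicDist (d : ℕ) : ℕ := min (d % 24) (24 - d % 24)

def gridColors : List ℕ := [2, 3, 4, 5, 6, 7, 8, 9, 10, 11, 12, 13, 14, 15, 22, 23]

theorem gridEntry_mem : ∀ x < 24, ∀ y < 24, (x + y) % 2 = 1 → gridEntry x y ∈ gridColors := by
  decide +kernel

-- Adding 24 keeps the natural subtraction from truncating and does not affect `cyclicDist`.
theorem gridCells_separated : gridColors.all (fun c => (gridCells c).all fun p =>
    (gridCells c).all fun q => p == q ||
      Nat.blt c (cyclicDist (p.1 + 24 - q.1) + cyclicDist (p.2 + 24 - q.2))) = true := by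
  decide +kernel

/-- The periodic extension of the table `gridRows`. -/
def gridColor (x y : ℤ) : ℕ := gridEntry (x % 24).toNat (y % 24).toNat

theorem gridColor_mem {x y : ℤ} (h : (x + y) % 2 = 1) : gridColor x y ∈ gridColors :=
  gridEntry_mem _ (by omega) _ (by omega) (by omega)

theorem gridColor_congr {x y x' y' : ℤ} (hx : x % 24 = x' % 24) (hy : y % 24 = y' % 24) :
    gridColor x y = gridColor x' y' := by
  rw [gridColor, gridColor, hx, hy]

theorem mem_gridCells {c x y : ℕ} :
    (x, y) ∈ gridCells c ↔ (x < 24 ∧ y < 24) ∧ gridEntry x y = c := by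
  simp [gridCells, List.mem_filter]

theorem cyclicDist_le_abs_sub (x x' : ℤ) :
    (cyclicDist ((x % 24).toNat + 24 - (x' % 24).toNat) : ℤ) ≤ |x - x'| := by
  rw [cyclicDist, abs_eq_max_neg]
  omega

theorem eq_or_le_abs_sub {x x' : ℤ} (h : (x % 24).toNat = (x' % 24).toNat) :
    x = x' ∨ 24 ≤ |x - x'| := by
  rw [abs_eq_max_neg]
  omega

theorem gridColor_packing {x y x' y' : ℤ} (h : (x + y) % 2 = 1)
    (heq : gridColor x y = gridColor x' y') (hne : ¬(x = x' ∧ y = y')) :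
    (gridColor x y : ℤ) < |x - x'| + |y - y'| := by
  have hmem := gridColor_mem h
  have key := gridCells_separated
  simp only [List.all_eq_true, Bool.or_eq_true, beq_iff_eq, Nat.blt_eq] at key
  have hle : gridColor x y ≤ 23 := by
    have : ∀ c ∈ gridColors, c ≤ 23 := by decide
    exact this _ hmem
  rcases key _ hmem ((x % 24).toNat, (y % 24).toNat)
    (mem_gridCells.2 ⟨⟨by omega, by omega⟩, rfl⟩) ((x' % 24).toNat, (y' % 24).toNat)
    (mem_gridCells.2 ⟨⟨by omega, by omega⟩, heq.symm⟩) with hxy | hlt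
  · rw [Prod.mk.injEq] at hxy
    have := abs_nonneg (x - x')
    have := abs_nonneg (y - y')
    -- Distinct points over the same table cell are at least 24 apart, while table colors are at
    -- most 23.
    rcases eq_or_le_abs_sub hxy.1 with hx | hx <;> rcases eq_or_le_abs_sub hxy.2 with hy | hy
    · exact absurd ⟨hx, hy⟩ hne
    all_goals omega
  · have := cyclicDist_le_abs_sub x x'
    have := cyclicDist_le_abs_sub y y'
    dsimp only at hlt
    omega

/-- One period of a coloring of the path with the colors `16, ..., 21, 24, ..., 30` in which two
vertices of color `c` are more than `c / 2` apart. -/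
def lineList : List ℕ :=
  [24, 27, 20, 17, 26, 30, 16, 29, 28, 18, 19, 25, 17, 24, 21, 16, 20, 27, 26, 18,
   19, 30, 29, 28, 17, 21, 16, 20, 25, 18, 24, 27, 26, 17, 19, 16, 21, 29, 28, 18,
   20, 30, 25, 24, 17, 19, 27, 21, 16, 18, 26, 20, 29, 28, 17, 19, 25, 16, 21, 18]

def lineEntry (i : ℕ) : ℕ := lineList.getD i 0

theorem lineEntry_mem : ∀ i < 60, lineEntry i ∈ Finset.Icc 16 30 ∧ lineEntry i ∉ gridColors := by
  decide +kernel

theorem lineEntry_separated : ∀ i < 60, ∀ j < i, lineEntry i = lineEntry j →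
    lineEntry i < 2 * (i - j) ∧ lineEntry i < 2 * (60 + j - i) := by
  decide +kernel

/-- The periodic extension of `lineList`. -/
def lineColor (i : ℤ) : ℕ := lineEntry (i % 60).toNat

theorem lineColor_mem (i : ℤ) : lineColor i ∈ Finset.Icc 16 30 ∧ lineColor i ∉ gridColors :=
  lineEntry_mem _ (by omega)

theorem lineColor_congr {i j : ℤ} (h : i % 60 = j % 60) : lineColor i = lineColor j := by
  rw [lineColor, lineColor, h]

theorem lineColor_packing {i j : ℤ} (heq : lineColor i = lineColor j) (hne : i ≠ j) :
    (lineColor i : ℤ) < 2 * |i - j| := by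
  have hle := (Finset.mem_Icc.1 (lineColor_mem i).1).2
  rcases lt_trichotomy (i % 60).toNat (j % 60).toNat with h | h | h
  · have := lineEntry_separated _ (by omega) _ h heq.symm
    rw [show lineEntry (j % 60).toNat = lineColor i from heq.symm] at this
    generalize lineColor i = c at *
    simp only [abs_eq_max_neg] at *
    omega
  · generalize lineColor i = c at *
    simp only [abs_eq_max_neg] at *
    omega
  · have := lineEntry_separated _ (by omega) _ h heq
    rw [show lineEntry (i % 60).toNat = lineColor i from rfl] at this
    generalize lineColor i = c at *
    simp only [abs_eq_max_neg] at *
    omega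

/-! ### Inserting columns into the grid pattern -/

/-- Data for cutting the grid along the vertical lines `x = pos n`: the part of the plane behind the
`n`-th line is shifted vertically by `shift n`, and the `n`-th line itself is colored by the line
pattern with offset `offset n`. The `n`-th line is the first one that is not left of `x` if
`n = index x`. -/
structure Cutting where
  pos : ℤ → ℤ
  shift : ℤ → ℤ
  offset : ℤ → ℤ
  index : ℤ → ℤ
  pos_step : ∀ n, pos n + 25 ≤ pos (n + 1)
  pos_parity : ∀ n, (pos n - n) % 2 = 0
  shift_step : ∀ n, |shift (n + 1) - shift n| ≤ 1
  shift_parity : ∀ n, (shift n - n) % 2 = 0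
  offset_step : ∀ n, 7 ≤ offset (n + 1) - offset n ∧ offset (n + 1) - offset n ≤ 25
  offset_parity : ∀ n, (offset n - n) % 2 = 0
  lt_index : ∀ x, pos (index x - 1) < x
  le_index : ∀ x, x ≤ pos (index x)

namespace Cutting

variable (C : Cutting)

theorem pos_add (n : ℤ) (j : ℕ) : C.pos n + 25 * j ≤ C.pos (n + j) := by
  induction j with
  | zero => simp
  | succ j ih =>
    have := C.pos_step (n + j)
    push_cast
    rw [← add_assoc]
    linarith

theorem shift_add (n : ℤ) (j : ℕ) : |C.shift (n + j) - C.shift n| ≤ j := by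
  induction j with
  | zero => simp
  | succ j ih =>
    have := C.shift_step (n + j)
    push_cast
    rw [← add_assoc]
    rw [abs_le] at *
    constructor <;> linarith [this.1, this.2, ih.1, ih.2]

theorem pos_le_pos {n n' : ℤ} (h : n ≤ n') : C.pos n + 25 * (n' - n) ≤ C.pos n' := by
  have := C.pos_add n (n' - n).toNat
  rw [Int.toNat_of_nonneg (by omega)] at this
  simpa using this

theorem abs_shift_sub_le {n n' : ℤ} (h : n ≤ n') : |C.shift n' - C.shift n| ≤ n' - n := by
  have := C.shift_add n (n' - n).toNat
  rw [Int.toNat_of_nonneg (by omega)] at this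
  simpa using this

theorem index_unique {x n : ℤ} (h₁ : C.pos (n - 1) < x) (h₂ : x ≤ C.pos n) : C.index x = n := by
  have h₃ := C.lt_index x
  have h₄ := C.le_index x
  rcases lt_trichotomy (C.index x) n with h | h | h
  · have := C.pos_le_pos (show C.index x ≤ n - 1 by omega)
    omega
  · exact h
  · have := C.pos_le_pos (show n ≤ C.index x - 1 by omega)
    omega

theorem index_mono {x x' : ℤ} (h : x ≤ x') : C.index x ≤ C.index x' := by
  by_contra! hlt
  have := C.pos_le_pos (show C.index x' ≤ C.index x - 1 by omega)
  have := C.lt_index x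
  have := C.le_index x'
  omega

/-- The coloring of the square grid obtained from a cutting. -/
def color (x y : ℤ) : ℕ :=
  if (x + y) % 2 = 0 then 1
  else if C.pos (C.index x) = x then lineColor ((y + C.offset (C.index x)) / 2)
  else gridColor (x - C.index x) (y + C.shift (C.index x))

theorem color_mem (x y : ℤ) : C.color x y ∈ Set.Icc 1 30 := by
  unfold color
  split_ifs with h₁ h₂
  · simp
  · have := Finset.mem_Icc.1 (lineColor_mem ((y + C.offset (C.index x)) / 2)).1
    exact ⟨by omega, by omega⟩
  · have hb : ∀ c ∈ gridColors, 1 ≤ c ∧ c ≤ 30 := by decide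
    have := C.shift_parity (C.index x)
    exact hb _ (gridColor_mem (by omega))

theorem color_line {x y : ℤ} (h : (x + y) % 2 = 1) (hx : C.pos (C.index x) = x) :
    C.color x y = lineColor ((y + C.offset (C.index x)) / 2) := by
  rw [color, if_neg (by omega), if_pos hx]

theorem color_grid {x y : ℤ} (h : (x + y) % 2 = 1) (hx : C.pos (C.index x) ≠ x) :
    C.color x y = gridColor (x - C.index x) (y + C.shift (C.index x)) := by
  rw [color, if_neg (by omega), if_neg hx]

theorem color_grid_mem {x y : ℤ} (h : (x + y) % 2 = 1) (hx : C.pos (C.index x) ≠ x) :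
    C.color x y ∈ gridColors := by
  have := C.shift_parity (C.index x)
  rw [C.color_grid h hx]
  exact gridColor_mem (by omega)

theorem color_eq_one_iff {x y : ℤ} : C.color x y = 1 ↔ (x + y) % 2 = 0 := by
  refine ⟨fun h => ?_, fun h => by rw [color, if_pos h]⟩
  by_contra hodd
  by_cases hx : C.pos (C.index x) = x
  · rw [C.color_line (by omega) hx] at h
    have := Finset.mem_Icc.1 (lineColor_mem ((y + C.offset (C.index x)) / 2)).1
    omega
  · have := C.color_grid_mem (y := y) (by omega) hx
    rw [h] at this
    exact absurd this (by decide)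

/-- On one line, odd points sit 2 apart, so pattern distance doubles. On consecutive lines, equal
pattern positions differ by at least 7 vertically and 25 horizontally, and `7 + 25 > 30`; for
different positions, an offset of at most 25 is made up by the gap of at least 25. Lines further
apart are at distance at least 50. -/
theorem color_packing_line {x y x' y' : ℤ} (h : (x + y) % 2 = 1) (h' : (x' + y') % 2 = 1)
    (hx : C.pos (C.index x) = x) (hx' : C.pos (C.index x') = x') (hle : x ≤ x')
    (heq : C.color x y = C.color x' y') (hne : ¬(x = x' ∧ y = y')) :
    (C.color x y : ℤ) < |x - x'| + |y - y'| := by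
  have hmax := (C.color_mem x y).2
  have hmono := C.index_mono hle
  have hp := C.pos_parity (C.index x)
  have hp' := C.pos_parity (C.index x')
  have ho := C.offset_parity (C.index x)
  have ho' := C.offset_parity (C.index x')
  have hgap := C.pos_le_pos hmono
  rw [hx] at hp hgap
  rw [hx'] at hp' hgap
  have hc := C.color_line h hx
  have hpack := lineColor_packing (i := (y + C.offset (C.index x)) / 2)
    (j := (y' + C.offset (C.index x')) / 2)
    (by rw [← hc, heq, C.color_line h' hx'])
  rw [← hc] at hpack
  generalize C.color x y = c at *
  rcases (show C.index x' = C.index x ∨ C.index x' = C.index x + 1 ∨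
    C.index x + 2 ≤ C.index x' by omega) with hn | hn | hn
  · have hxx : x = x' := by rw [← hx, ← hx', hn]
    rw [hn] at hpack
    have := hpack (by omega)
    simp only [abs_eq_max_neg] at *
    omega
  · have hs := C.offset_step (C.index x)
    rw [← hn] at hs
    by_cases hij : (y + C.offset (C.index x)) / 2 = (y' + C.offset (C.index x')) / 2
    · simp only [abs_eq_max_neg] at *
      omega
    · have := hpack hij
      simp only [abs_eq_max_neg] at *
      omega
  · simp only [abs_eq_max_neg] at *
    omega

/-- Crossing `j` lines removes `j` from the horizontal table distance and changes the vertical one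
by at most `j`, so table distance is at most `j - j = 0` more than true distance. -/
theorem color_packing_grid {x y x' y' : ℤ} (h : (x + y) % 2 = 1) (h' : (x' + y') % 2 = 1)
    (hx : C.pos (C.index x) ≠ x) (hx' : C.pos (C.index x') ≠ x') (hle : x ≤ x')
    (heq : C.color x y = C.color x' y') (hne : ¬(x = x' ∧ y = y')) :
    (C.color x y : ℤ) < |x - x'| + |y - y'| := by
  have hmono := C.index_mono hle
  have hs := C.abs_shift_sub_le hmono
  have hc := C.color_grid h hx
  have hpar := C.shift_parity (C.index x)
  have hpack := gridColor_packing (x := x - C.index x) (y := y + C.shift (C.index x))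
    (x' := x' - C.index x') (y' := y' + C.shift (C.index x')) (by omega)
    (by rw [← hc, heq, C.color_grid h' hx'])
  rw [← hc] at hpack
  generalize C.color x y = c at *
  rcases hmono.eq_or_lt with hn | hn
  · rw [← hn] at hpack
    have := hpack (by omega)
    simp only [abs_eq_max_neg] at *
    omega
  · have h₁ := C.pos_le_pos (show C.index x ≤ C.index x' - 1 by omega)
    have h₂ := C.le_index x
    have h₃ := C.lt_index x'
    -- Both points are off the lines, so they stay in distinct table columns once the inserted ones
    -- are removed.
    have := hpack (by omega)
    simp only [abs_eq_max_neg] at *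
    omega

theorem color_packing_of_le {x y x' y' : ℤ} (hle : x ≤ x')
    (heq : C.color x y = C.color x' y') (hne : ¬(x = x' ∧ y = y')) :
    (C.color x y : ℤ) < |x - x'| + |y - y'| := by
  by_cases h1 : C.color x y = 1
  · have h := C.color_eq_one_iff.1 h1
    have h' := C.color_eq_one_iff.1 (heq ▸ h1)
    rw [h1]
    push_cast
    simp only [abs_eq_max_neg] at *
    omega
  · have h : (x + y) % 2 = 1 := by
      have := mt C.color_eq_one_iff.2 h1
      omega
    have h' : (x' + y') % 2 = 1 := by
      have := mt C.color_eq_one_iff.2 (heq ▸ h1)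
      omega
    by_cases hx : C.pos (C.index x) = x <;> by_cases hx' : C.pos (C.index x') = x'
    · exact C.color_packing_line h h' hx hx' hle heq hne
    · have := C.color_grid_mem h' hx'
      rw [← heq, C.color_line h hx] at this
      exact absurd this (lineColor_mem _).2
    · have := C.color_grid_mem h hx
      rw [heq, C.color_line h' hx'] at this
      exact absurd this (lineColor_mem _).2
    · exact C.color_packing_grid h h' hx hx' hle heq hne

theorem color_packing {x y x' y' : ℤ} (heq : C.color x y = C.color x' y')
    (hne : ¬(x = x' ∧ y = y')) : (C.color x y : ℤ) < |x - x'| + |y - y'| := by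
  rcases le_total x x' with hle | hle
  · exact C.color_packing_of_le hle heq hne
  · rw [heq, abs_sub_comm x, abs_sub_comm y]
    exact C.color_packing_of_le hle heq.symm (by tauto)

/-- Translation by `t` crosses exactly `m` lines. The offset is needed mod 120 because line
positions are halved before reduction mod 60. -/
theorem color_periodic {m t k : ℤ} (htm : (t - m) % 24 = 0) (htk : (t - k) % 2 = 0)
    (hpos : ∀ n, C.pos (n + m) = C.pos n + t)
    (hshift : ∀ n, (C.shift (n + m) - C.shift n - k) % 24 = 0)
    (hoffset : ∀ n, (C.offset (n + m) - C.offset n - k) % 120 = 0) (x y : ℤ) :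
    C.color (x + t) (y - k) = C.color x y := by
  have hindex : C.index (x + t) = C.index x + m := by
    refine C.index_unique ?_ ?_
    · rw [show C.index x + m - 1 = C.index x - 1 + m by ring, hpos]
      linarith [C.lt_index x]
    · rw [hpos]
      linarith [C.le_index x]
  have hs := hshift (C.index x)
  have ho := hoffset (C.index x)
  unfold color
  rw [hindex, hpos]
  have e₁ : (x + t + (y - k)) % 2 = 0 ↔ (x + y) % 2 = 0 := by omega
  have e₂ : C.pos (C.index x) + t = x + t ↔ C.pos (C.index x) = x := by omega
  simp only [e₁, e₂]
  split_ifs with h₁ h₂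
  · rfl
  · exact lineColor_congr (by omega)
  · exact gridColor_congr (by omega) (by omega)

end Cutting

/-! ### Construction of the cutting -/

/-- The function on `ℤ` that agrees with `f` on `0, ..., m` if `f 0 = 0` and grows by `f m` over
each interval of length `m`. -/
def quasiPeriodic (m : ℤ) (f : ℤ → ℤ) (n : ℤ) : ℤ := f m * (n / m) + f (n % m)

section quasiPeriodic

variable {m : ℤ} {f : ℤ → ℤ}

theorem quasiPeriodic_add (hm : 0 < m) (n : ℤ) :
    quasiPeriodic m f (n + m) = quasiPeriodic m f n + f m := by
  simp only [quasiPeriodic, Int.add_emod_right]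
  rw [Int.add_ediv_of_dvd_right dvd_rfl, Int.ediv_self hm.ne']
  ring

theorem quasiPeriodic_mul_add (hm : 0 < m) (h0 : f 0 = 0) {w l : ℤ} (hl : 0 ≤ l) (hlm : l ≤ m) :
    quasiPeriodic m f (m * w + l) = f m * w + f l := by
  rcases hlm.eq_or_lt with rfl | hlt
  · rw [quasiPeriodic_add hm]
    simp [quasiPeriodic, hm.ne', h0]
  · rw [quasiPeriodic, add_comm (m * w), Int.add_mul_ediv_left _ _ hm.ne', Int.add_mul_emod_self_left,
      Int.ediv_eq_zero_of_lt hl hlt, Int.emod_eq_of_lt hl hlt, zero_add]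

theorem quasiPeriodic_step (hm : 0 < m) (h0 : f 0 = 0) {P : ℤ → Prop}
    (hP : ∀ l, 0 ≤ l → l < m → P (f (l + 1) - f l)) (n : ℤ) :
    P (quasiPeriodic m f (n + 1) - quasiPeriodic m f n) := by
  have hl := Int.emod_nonneg n hm.ne'
  have hlm := Int.emod_lt_of_pos n hm
  have hn := Int.mul_ediv_add_emod n m
  have h₁ := quasiPeriodic_mul_add hm h0 (w := n / m) hl hlm.le
  have h₂ := quasiPeriodic_mul_add hm h0 (w := n / m) (l := n % m + 1) (by omega) (by omega)
  rw [← add_assoc, hn] at h₂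
  rw [hn] at h₁
  rw [h₁, h₂, add_sub_add_left_eq_sub]
  exact hP _ hl hlm

theorem quasiPeriodic_parity (hm : 0 < m) (h0 : f 0 = 0)
    (hP : ∀ l, 0 ≤ l → l < m → (f (l + 1) - f l) % 2 = 1) (n : ℤ) :
    (quasiPeriodic m f n - n) % 2 = 0 := by
  have hstep := quasiPeriodic_step hm h0 (P := fun d => d % 2 = 1) hP
  induction n using Int.induction_on with
  | zero => simp [quasiPeriodic, h0]
  | succ i ih =>
    have := hstep i
    omega
  | pred i ih =>
    have := hstep (-i - 1)
    rw [sub_add_cancel] at this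
    omega

theorem exists_quasiPeriodic_lt_le (hm : 0 < m) (h0 : f 0 = 0) (hpos : 0 < f m)
    (hmono : ∀ l, 0 ≤ l → l < m → f l < f (l + 1)) (x : ℤ) :
    ∃ n, quasiPeriodic m f (n - 1) < x ∧ x ≤ quasiPeriodic m f n := by
  have hstep := quasiPeriodic_step hm h0 (P := fun d => 0 < d)
    fun l hl hlm => by linarith [hmono l hl hlm]
  have hmono : Monotone (quasiPeriodic m f) :=
    monotone_int_of_le_succ fun n => by linarith [hstep n]
  have hmul (w : ℤ) : quasiPeriodic m f (m * w) = f m * w := by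
    have := quasiPeriodic_mul_add hm h0 (w := w) le_rfl hm.le
    simpa [h0] using this
  obtain ⟨n, hn, hmin⟩ := Int.exists_least_of_bdd (P := fun n => x ≤ quasiPeriodic m f n)
    ⟨m * (-|x| - 1), fun z hz => by
      by_contra! hlt
      have h₁ := hmono hlt.le
      rw [hmul] at h₁
      nlinarith [neg_abs_le x, abs_nonneg x]⟩
    ⟨m * |x|, by
      rw [hmul]
      nlinarith [le_abs_self x, abs_nonneg x]⟩
  exact ⟨n, by
    by_contra! h
    have := hmin _ h
    omega, hn⟩

end quasiPeriodic

theorem exists_cutting {k t : ℤ} (hk : k % 2 = 1) (ht : t % 2 = 1) (h825 : 825 ≤ t) :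
    ∃ C : Cutting, ∀ x y, C.color (x + t) (y - k) = C.color x y := by
  -- As `t` is odd, `m` is odd and so at most 33. The lower bound 11 leaves room for any `a < 12`.
  obtain ⟨m, hm11, hm33, htm⟩ : ∃ m : ℤ, 11 ≤ m ∧ m ≤ 33 ∧ (t - m) % 24 = 0 :=
    ⟨(t - 11) % 24 + 11, by omega, by omega, by omega⟩
  -- `a` counts the upward slides among the `m`; the total is `2 * a - m`.
  obtain ⟨a, ha0, ham, ha⟩ : ∃ a : ℤ, 0 ≤ a ∧ a ≤ m ∧ (2 * a - m - k) % 24 = 0 :=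
    ⟨(m + k) / 2 % 12, by omega, by omega, by omega⟩
  -- Each offset step is 7 plus twice a number from 0 to 9; `e` is the sum of these numbers.
  obtain ⟨e, he0, hem, he⟩ : ∃ e : ℤ, 0 ≤ e ∧ e ≤ 9 * m ∧ (7 * m + 2 * e - k) % 120 = 0 :=
    ⟨(k - 7 * m) / 2 % 60, by omega, by omega, by omega⟩
  have hm : 0 < m := by omega
  -- All gaps are 25 except the last, which absorbs the remainder of `t`.
  let p : ℤ → ℤ := fun l => if l = m then t else 25 * l
  let s : ℤ → ℤ := fun l => 2 * min l a - l
  let o : ℤ → ℤ := fun l => 7 * l + 2 * min e (9 * l)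
  have hp0 : p 0 = 0 := by simp only [p]; split_ifs <;> omega
  have hs0 : s 0 = 0 := by simp only [s]; omega
  have ho0 : o 0 = 0 := by simp only [o]; omega
  have hpm : p m = t := if_pos rfl
  have hsm : s m = 2 * a - m := by simp only [s]; omega
  have hom : o m = 7 * m + 2 * e := by simp only [o]; omega
  have hp (l : ℤ) (h0 : 0 ≤ l) (hl : l < m) :
      25 ≤ p (l + 1) - p l ∧ (p (l + 1) - p l) % 2 = 1 := by
    simp only [p]; split_ifs <;> omega
  have hs (l : ℤ) (h0 : 0 ≤ l) (hl : l < m) :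
      |s (l + 1) - s l| ≤ 1 ∧ (s (l + 1) - s l) % 2 = 1 := by
    simp only [s, abs_eq_max_neg]; omega
  have ho (l : ℤ) (h0 : 0 ≤ l) (hl : l < m) :
      (7 ≤ o (l + 1) - o l ∧ o (l + 1) - o l ≤ 25) ∧ (o (l + 1) - o l) % 2 = 1 := by
    simp only [o]; omega
  choose index hlt hle using exists_quasiPeriodic_lt_le hm hp0 (by omega)
    fun l h0 hl => by linarith [(hp l h0 hl).1]
  let C : Cutting :=
    { pos := quasiPeriodic m p
      shift := quasiPeriodic m s
      offset := quasiPeriodic m o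
      index := index
      pos_step := fun n => by
        have := quasiPeriodic_step hm hp0 (P := fun d => 25 ≤ d) (fun l h0 hl => (hp l h0 hl).1) n
        linarith
      pos_parity := quasiPeriodic_parity hm hp0 fun l h0 hl => (hp l h0 hl).2
      shift_step := quasiPeriodic_step hm hs0 (P := fun d => |d| ≤ 1) fun l h0 hl => (hs l h0 hl).1
      shift_parity := quasiPeriodic_parity hm hs0 fun l h0 hl => (hs l h0 hl).2
      offset_step := quasiPeriodic_step hm ho0 (P := fun d => 7 ≤ d ∧ d ≤ 25)
        fun l h0 hl => (ho l h0 hl).1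
      offset_parity := quasiPeriodic_parity hm ho0 fun l h0 hl => (ho l h0 hl).2
      lt_index := hlt
      le_index := hle }
  refine ⟨C, C.color_periodic (m := m) htm (by omega) (fun n => ?_) (fun n => ?_) fun n => ?_⟩
  · change quasiPeriodic m p (n + m) = quasiPeriodic m p n + t
    rw [quasiPeriodic_add hm, hpm]
  · change (quasiPeriodic m s (n + m) - quasiPeriodic m s n - k) % 24 = 0
    rw [quasiPeriodic_add hm, hsm]
    omega
  · change (quasiPeriodic m o (n + m) - quasiPeriodic m o n - k) % 120 = 0
    rw [quasiPeriodic_add hm, hom]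
    omega

/-! ### From the grid to the distance graph -/

/-- A walk lifts to the grid: steps of `±k` and `±t` become horizontal and vertical unit steps. -/
theorem exists_eq_of_walk {k t : ℕ} {u v : ℤ} (w : (distanceGraph {k, t}).Walk u v) :
    ∃ a b : ℤ, v = u + k * a + t * b ∧ |a| + |b| ≤ w.length := by
  induction w with
  | nil => exact ⟨0, 0, by simp, by simp⟩
  | cons h w ih =>
    rename_i u v' z
    obtain ⟨a, b, hab, hlen⟩ := ih
    rw [SimpleGraph.Walk.length_cons]
    push_cast
    rcases h.2 with h | h
    · rcases (show v' = u + k ∨ v' = u - k by omega) with rfl | rfl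
      · exact ⟨a + 1, b, by rw [hab]; ring, by simp only [abs_eq_max_neg] at *; omega⟩
      · exact ⟨a - 1, b, by rw [hab]; ring, by simp only [abs_eq_max_neg] at *; omega⟩
    · have h : (u - v').natAbs = t := h
      rcases (show v' = u + t ∨ v' = u - t by omega) with rfl | rfl
      · exact ⟨a, b + 1, by rw [hab]; ring, by simp only [abs_eq_max_neg] at *; omega⟩
      · exact ⟨a, b - 1, by rw [hab]; ring, by simp only [abs_eq_max_neg] at *; omega⟩

theorem isPacking_distanceGraph {k t i : ℕ} {X : Set ℤ}
    (hX : ∀ u ∈ X, ∀ a b : ℤ, u + k * a + t * b ∈ X → ¬(a = 0 ∧ b = 0) → (i : ℤ) < |a| + |b|) :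
    IsPacking (distanceGraph {k, t}) i X := by
  intro u hu v hv huv
  by_contra! hle
  obtain ⟨w, hw⟩ := SimpleGraph.exists_walk_of_edist_ne_top
    (ne_top_of_le_ne_top (ENat.natCast_ne_top i) hle)
  rw [← hw, Nat.cast_le] at hle
  obtain ⟨a, b, rfl, hab⟩ := exists_eq_of_walk w
  have := hX u hu a b hv (by rintro ⟨rfl, rfl⟩; simp at huv)
  omega

theorem color_combination {k t : ℤ} {C : Cutting}
    (hC : ∀ x y, C.color (x + t) (y - k) = C.color x y) (x y n : ℤ) :
    C.color (x + t * n) (y - k * n) = C.color x y := by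
  induction n using Int.induction_on with
  | zero => simp
  | succ i ih => rw [← ih, ← hC (x + t * i)]; ring_nf
  | pred i ih => rw [← ih, ← hC (x + t * (-i - 1))]; ring_nf

theorem exists_isPackingColoring {k t : ℕ} (hkodd : Odd k) (htodd : Odd t) (ht : 825 ≤ t)
    (hkt : Nat.Coprime k t) : ∃ c : ℤ → ℕ, IsPackingColoring (distanceGraph {k, t}) 30 c := by
  obtain ⟨C, hC⟩ := exists_cutting (k := k) (t := t) (by have := Nat.odd_iff.1 hkodd; omega)
    (by have := Nat.odd_iff.1 htodd; omega) (by omega)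
  obtain ⟨r, s, hrs⟩ := Nat.isCoprime_iff_coprime.2 hkt
  have hcolor (u a b : ℤ) : C.color ((u + k * a + t * b) * r) ((u + k * a + t * b) * s) =
      C.color (u * r + a) (u * s + b) := by
    -- By `r * k + s * t = 1`, the two grid points differ by this multiple of `(t, -k)`.
    rw [← color_combination hC (u * r + a) (u * s + b) (b * r - a * s)]
    congr 1
    · linear_combination a * hrs
    · linear_combination b * hrs
  refine ⟨fun u => C.color (u * r) (u * s), fun u => C.color_mem _ _, fun i _ =>
    isPacking_distanceGraph fun u hu a b hv hab => ?_⟩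
  simp only [Set.mem_ofPred_eq] at hu hv
  rw [hcolor] at hv
  have := C.color_packing (hu.trans hv.symm) (by simpa using hab)
  rw [hu] at this
  simpa using this

end PackingColoring

theorem theorem1 (k t : ℕ) (hk : 0 < k) (hkodd : Odd k) (htodd : Odd t) (ht : 825 ≤ t)
    (hkt : Nat.Coprime k t) :
    PackingColoring.packingChromaticNumber (PackingColoring.distanceGraph {k, t}) ≤ 30 :=
  iInf₂_le_of_le 30 (PackingColoring.exists_isPackingColoring hkodd htodd ht hkt) le_rfl
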